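/- Let $(X,d)$ be a compact metric space with at least two points, let $f:X\to X$ be a continuous surjective map, and let $\lambda_1,\lambda_2,\varepsilon_0>0$. For $x\in X$ and $n\ge 1$ put $$B_n(x,\varepsilon_0,\lambda_1,\lambda_2,f)=\{y\in X: d(f^i(x),f^i(y))<\varepsilon_0 e^{-\min\{i\lambda_1,(n-1-i)\lambda_2\}}\ \text{for all } 0\le i\le n-1\}.$$ Suppose that $(X,f)$ has the exponential non-uniform specification property with exponent $(\lambda_1,\lambda_2)$ at scale $\varepsilon_0$: there are positive integers $p(n)$, $n\ge 1$, with $\limsup_{n\to\infty}p(n)/n=0$, such that for all $x_1,\dots,x_k\in X$, all positive integers $n_1,\dots,n_k$ and all integers $p_i\ge p(n_i)$ there is $z\in X$ with $f^{\,n_1+p_1+\cdots+n_{i-1}+p_{i-1}}(z)\in B_{n_i}(x_i,\varepsilon_0,\lambda_1,\lambda_2,f)$ for every $1\le i\le k$ (for $i=1$ the exponent is $0$). For each $j\ge 1$ let $\varphi_j:\mathbb{N}\to(0,1]$, let $\mathcal Z_j=(z_j^n)_{n\ge 0}$ be a sequence in $X$, and let $S_j=\{s_j^i\}_{i\ge 0}\subset\mathbb{N}$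 with $\lim_{i\to\infty}s_j^i=\infty$. Put $$\mathfrak S_j=\{x\in X: d(f^n(x),z_j^n)<\varphi_j(n)\text{ for infinitely many }n\in S_j\},\qquad \overline\tau=\sup_{j\ge 1}\ \limsup_{n\to\infty}-\frac{\ln\varphi_j(n)}{n}.$$ Let $h_{top}(f,X)\in[0,\infty]$ be the topological entropy of $f$. For $Z\subseteq X$ let $h_{top}(f,Z)$ be the Bowen topological entropy of $f$ on $Z$, that is, $\lim_{\varepsilon\to 0}\inf\{s\ge 0:\lim_{N\to\infty}\mathcal M^s_{N,\varepsilon}(Z)=0\}$, where $\mathcal M^s_{N,\varepsilon}(Z)$ is the infimum of $\sum_i e^{-sn_i}$ over all countable covers of $Z$ by Bowen balls $\{y: d(f^k(x_i),f^k(y))<\varepsilon,\ 0\le k<n_i\}$ with $x_i\in X$ and $n_i\ge N$. Let $\dim_H$ denote Hausdorff dimension. If $\overline\tau<\lambda_1$, then $\bigcap_{j\ge 1}\mathfrak S_j$ is non-empty and $$h_{top}\Big(f,\bigcap_{j\ge 1}\mathfrak S_j\Big)\ \ge\ \frac{\lambda_1\lambda_2-\lambda_2\overline\tau}{\lambda_1\lambda_2+\lambda_1\overline\tau}\,h_{top}(f,X).$$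 Moreover: (1) if $f$ is Lipschitz with constant $L$, then $$\dim_H\bigcap_{j\ge 1}\mathfrak S_j\ \ge\ \frac{1}{\ln L}\,\frac{\lambda_1\lambda_2-\lambda_2\overline\tau}{\lambda_1\lambda_2+\lambda_1\overline\tau}\,h_{top}(f,X);$$ (2) if $f$ is a homeomorphism, $f^{-1}$ is Lipschitz with constant $L_1$ and $f$ is Lipschitz with constant $L_2$, then $$\dim_H\bigcap_{j\ge 1}\mathfrak S_j\ \ge\ \Big(\frac{1}{\ln L_1}+\frac{1}{\ln L_2}\,\frac{\lambda_1\lambda_2-\lambda_2\overline\tau}{\lambda_1\lambda_2+\lambda_1\overline\tau}\Big)h_{top}(f,X).$$ (Under these hypotheses every such Lipschitz constant $L$, $L_1$, $L_2$ is larger than $1$.) -/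

import Mathlib

open Filter Topology Set
open scoped ENNReal NNReal

namespace ShrinkingTarget

noncomputable section

/-- The dynamical (Bowen) ball `B_n(x, ε, f)`. -/
def bowenBall {X : Type*} [MetricSpace X] (f : X → X) (n : ℕ) (x : X) (ε : ℝ) : Set X :=
  {y | ∀ i < n, dist (f^[i] x) (f^[i] y) < ε}

/-- The exponential Bowen ball `B_n(x, ε, l₁, l₂, f)`. -/
def expBowenBall {X : Type*} [MetricSpace X] (f : X → X) (l₁ l₂ : ℝ) (n : ℕ) (x : X) (ε : ℝ) :
    Set X :=
  {y | ∀ i < n, dist (f^[i] x) (f^[i] y) <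
    ε * Real.exp (-(min ((i : ℝ) * l₁) (((n : ℝ) - 1 - i) * l₂)))}

/-- The exponential non-uniform specification property with exponent `(l₁, l₂)` at scale `ε`.
The finitely many orbit segments are the entries with index `i < k` of the sequences `x, n, q`;
the `i`-th one is shadowed from time `∑ j < i, (n j + q j)` on. As `p m / m ≥ 0`, the condition
`limsup p m / m = 0` is convergence to `0`. -/
def ExpNonuniformSpecification {X : Type*} [MetricSpace X] (f : X → X) (l₁ l₂ ε : ℝ) : Prop :=
  ∃ p : ℕ → ℕ, (∀ m, 1 ≤ m → 1 ≤ p m) ∧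
    Tendsto (fun m : ℕ => (p m : ℝ) / m) atTop (𝓝 0) ∧
    ∀ (k : ℕ) (x : ℕ → X) (n q : ℕ → ℕ),
      (∀ i < k, 1 ≤ n i) → (∀ i < k, p (n i) ≤ q i) →
      ∃ z : X, ∀ i < k,
        f^[∑ j ∈ Finset.range i, (n j + q j)] z ∈ expBowenBall f l₁ l₂ (n i) (x i) ε

/-- The `S`-shrinking target set. -/
def targetSet {X : Type*} [MetricSpace X] (f : X → X) (φ : ℕ → ℝ) (z : ℕ → X) (S : Set ℕ) :
    Set X :=
  {x | {n | n ∈ S ∧ dist (f^[n] x) (z n) < φ n}.Infinite}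

/-- `limsup_{n → ∞} -ln φ(n) / n`, as an extended real number. -/
def shrinkingRate (φ : ℕ → ℝ) : EReal :=
  limsup (fun n : ℕ => ((-Real.log (φ n) / n : ℝ) : EReal)) atTop

/-- `M_{N,ε}^s(Z)`: the infimum of `∑ exp(-s n_i)` over the countable families of Bowen balls
`B_{n_i}(x_i, ε, f)` with `n_i ≥ N` that cover `Z`; a family is given by its set of pairs
`(x_i, n_i)`. -/
def bowenPremeasure {X : Type*} [MetricSpace X] (f : X → X) (Z : Set X) (s : ℝ≥0) (N : ℕ)
    (ε : ℝ) : ℝ≥0∞ :=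
  ⨅ (C : Set (X × ℕ)) (_ : C.Countable) (_ : ∀ c ∈ C, N ≤ c.2)
    (_ : Z ⊆ ⋃ c ∈ C, bowenBall f c.2 c.1 ε),
    ∑' c : C, ENNReal.ofReal (Real.exp (-(s : ℝ) * (c.1.2 : ℝ)))

/-- `M_ε^s(Z) = lim_{N → ∞} M_{N,ε}^s(Z)`, a limit of a nondecreasing sequence. -/
def bowenMeasure {X : Type*} [MetricSpace X] (f : X → X) (Z : Set X) (s : ℝ≥0) (ε : ℝ) : ℝ≥0∞ :=
  ⨆ N : ℕ, bowenPremeasure f Z s N ε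

/-- `h_top(f, Z, ε) = inf {s ≥ 0 : M_ε^s(Z) = 0}`, equal to `∞` if there is no such `s`. -/
def bowenEntropyAt {X : Type*} [MetricSpace X] (f : X → X) (Z : Set X) (ε : ℝ) : ℝ≥0∞ :=
  ⨅ (s : ℝ≥0) (_ : bowenMeasure f Z s ε = 0), (s : ℝ≥0∞)

/-- The Bowen topological entropy `h_top(f, Z) = lim_{ε → 0} h_top(f, Z, ε)` of an arbitrary
subset `Z`; the limit is a supremum because `h_top(f, Z, ε)` grows as `ε` decreases. -/
def bowenEntropy {X : Type*} [MetricSpace X] (f : X → X) (Z : Set X) : ℝ≥0∞ :=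
  ⨆ (ε : ℝ) (_ : 0 < ε), bowenEntropyAt f Z ε

/-- The ratio `(l₁ l₂ - l₂ τ) / (l₁ l₂ + l₁ τ)`. -/
def ratio (l₁ l₂ τ : ℝ) : ℝ := (l₁ * l₂ - l₂ * τ) / (l₁ * l₂ + l₁ * τ)

end

end ShrinkingTarget

/-! Fix `ρ` below the ratio, `y` below the entropy of `f`, and `r` slightly above the supremum of
the rates. A target at time `t` is placed inside a shadowed segment that starts `u` steps earlier
and ends `v` steps later. The error at time `t` is then `ε e^{-min(u l₁, v l₂)}`, so `u ≈ r t / l₁`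
and `v ≈ r t / l₂` suffice, while the gap after the segment is negligible. If the target times grow
fast enough, the free stretch before a window is about the fraction `(1 - r/l₁)/(1 + r/l₂) = ratio
l₁ l₂ r` of the time up to its end (`eventually_exists_target_segment`, `exists_isSchedule`).

Free time is cut into cells of a fixed length `P`. In each cell the orbit may shadow any letter of
an alphabet of at least `e^{yP}` separated points (`exists_alphabet`). Finite shadowing plus
compactness realises all prescriptions at once, which codes part of the target set by sequences of
letters (`OrbitWindow.exists_isCoding`).

The uniform product measure is pushed through the code. A Bowen ball of length `n` determines the
letters of at least `ρ n / P - 4` cells, so its mass is at most `C e^{-yρn}`, and the mass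
distribution principle bounds the entropy below by `yρ`. For Lipschitz `f`, points at distance at
most `d` stay close for about `log(δ/d)/log L` steps, which bounds the dimension. For a
homeomorphism no target lies at negative times, so every cell of the past is free and contributes at
the full rate `y`. Finally `y` and `ρ` tend to their bounds. -/

namespace ShrinkingTarget

/-! ### Shadowing: from finite sequences of segments to arbitrary families -/

variable {X : Type*} [MetricSpace X]

/-- `IsShadowingGap f l₁ l₂ ε p` says that `p` is a gap function in the exponential non-uniform
specification property: every finite sequence of orbit segments is shadowed as soon as the gaps
are at least as long as `p` prescribes. -/
def IsShadowingGap (f : X → X) (l₁ l₂ ε : ℝ) (p : ℕ → ℕ) : Prop :=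
  ∀ (k : ℕ) (x : ℕ → X) (n q : ℕ → ℕ),
    (∀ i < k, 1 ≤ n i) → (∀ i < k, p (n i) ≤ q i) →
    ∃ z : X, ∀ i < k,
      f^[∑ j ∈ Finset.range i, (n j + q j)] z ∈ expBowenBall f l₁ l₂ (n i) (x i) ε

/-- Shadowing of finitely many segments with prescribed starting times. -/
theorem IsShadowingGap.exists_of_starts {f : X → X} {l₁ l₂ ε : ℝ} {p : ℕ → ℕ}
    (hp : IsShadowingGap f l₁ l₂ ε p) (hsurj : Function.Surjective f)
    (k : ℕ) (a n : ℕ → ℕ) (x : ℕ → X) (hn : ∀ i < k, 1 ≤ n i)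
    (ha : ∀ i, i + 1 < k → a i + n i + p (n i) ≤ a (i + 1)) :
    ∃ z : X, ∀ i < k, f^[a i] z ∈ expBowenBall f l₁ l₂ (n i) (x i) ε := by
  obtain ⟨z, hz⟩ := hp k x n (fun i => if i + 1 < k then a (i + 1) - a i - n i else p (n i)) hn
    (by
      intro i _
      split_ifs with h
      · have := ha i h; omega
      · exact le_rfl)
  -- The specification property starts at time `0`; surjectivity delays the start to `a 0`.
  obtain ⟨w, hw⟩ := hsurj.iterate (a 0) z
  refine ⟨w, fun i hi => ?_⟩
  have key : ∀ i < k, a 0 + ∑ j ∈ Finset.range i,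
      (n j + (if j + 1 < k then a (j + 1) - a j - n j else p (n j))) = a i := by
    intro i
    induction i with
    | zero => intro _; simp
    | succ i ih =>
      intro h
      rw [Finset.sum_range_succ, ← add_assoc, ih (by omega), if_pos h]
      have := ha i h
      omega
  have := hz i hi
  rw [← hw, ← Function.iterate_add_apply, add_comm, key i hi] at this
  exact this

/-- Shadowing of finitely many segments indexed by their starting times. -/
theorem IsShadowingGap.exists_of_finset {f : X → X} {l₁ l₂ ε : ℝ} {p : ℕ → ℕ}
    (hp : IsShadowingGap f l₁ l₂ ε p) (hsurj : Function.Surjective f)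
    (I : Finset ℕ) (len : ℕ → ℕ) (pt : ℕ → X) (hlen : ∀ a ∈ I, 1 ≤ len a)
    (hI : ∀ a ∈ I, ∀ b ∈ I, a < b → a + len a + p (len a) ≤ b) :
    ∃ z : X, ∀ a ∈ I, f^[a] z ∈ expBowenBall f l₁ l₂ (len a) (pt a) ε := by
  let e := I.orderEmbOfFin rfl
  let a : ℕ → ℕ := fun i => if h : i < I.card then e ⟨i, h⟩ else 0
  have hae : ∀ i (h : i < I.card), a i = e ⟨i, h⟩ := fun i h => dif_pos h
  have haI : ∀ i < I.card, a i ∈ I := fun i h => by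
    rw [hae i h]; exact I.orderEmbOfFin_mem rfl _
  obtain ⟨z, hz⟩ := hp.exists_of_starts hsurj I.card a (fun i => len (a i)) (fun i => pt (a i))
    (fun i h => hlen _ (haI i h)) (fun i h => hI _ (haI i (by omega)) _ (haI _ h) (by
      rw [hae i (by omega), hae _ h]
      exact e.strictMono (by simp [Fin.lt_def])))
  refine ⟨z, fun b hb => ?_⟩
  have : b ∈ Set.range e := by rw [Finset.range_orderEmbOfFin]; exact hb
  obtain ⟨⟨i, hi⟩, rfl⟩ := this
  have := hz i hi
  rwa [hae i hi] at this

/-- Orbit maps `orb a` of `f`, for times `a` in an upper set `W` of integers. -/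
structure OrbitWindow (f : X → X) (W : Set ℤ) (orb : ℤ → X → X) : Prop where
  natCast_mem : ∀ n : ℕ, (n : ℤ) ∈ W
  orb_natCast : ∀ (n : ℕ) (x : X), orb n x = f^[n] x
  orb_add : ∀ a ∈ W, ∀ (i : ℕ) (x : X), orb (a + i) x = f^[i] (orb a x)
  continuous : ∀ a ∈ W, Continuous (orb a)
  surjective : ∀ a ∈ W, Function.Surjective (orb a)

theorem OrbitWindow.forward {f : X → X} (hf : Continuous f) (hsurj : Function.Surjective f) :
    OrbitWindow f (Set.Ici 0) (fun a => f^[a.toNat]) where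
  natCast_mem n := by simp
  orb_natCast n x := by simp
  orb_add a ha i x := by
    have : (a + i).toNat = i + a.toNat := by
      have : 0 ≤ a := ha
      omega
    rw [this, Function.iterate_add_apply]
  continuous a _ := hf.iterate _
  surjective a _ := hsurj.iterate _

theorem coe_homeomorph_pow (e : X ≃ₜ X) (n : ℕ) (x : X) : (e ^ n) x = (⇑e)^[n] x := by
  induction n generalizing x with
  | zero => rfl
  | succ n ih => rw [pow_succ, Homeomorph.mul_apply, ih, Function.iterate_succ_apply]

theorem OrbitWindow.twoSided (e : X ≃ₜ X) :
    OrbitWindow e Set.univ (fun a => ⇑(e ^ a)) where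
  natCast_mem n := trivial
  orb_natCast n x := by
    rw [zpow_natCast, coe_homeomorph_pow]
  orb_add a _ i x := by
    rw [add_comm, zpow_add, Homeomorph.mul_apply, zpow_natCast, coe_homeomorph_pow]
  continuous a _ := (e ^ a).continuous
  surjective a _ := (e ^ a).surjective

/-- Shadowing, up to closed errors, of an arbitrary family of segments indexed by their starting
times. -/
theorem OrbitWindow.exists_shadowing [CompactSpace X] {f : X → X} {W : Set ℤ} {orb : ℤ → X → X}
    (ho : OrbitWindow f W orb) (hf : Continuous f) (hsurj : Function.Surjective f)
    {l₁ l₂ ε : ℝ} {p : ℕ → ℕ} (hp : IsShadowingGap f l₁ l₂ ε p)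
    (I : Set ℤ) (hIW : I ⊆ W) (len : ℤ → ℕ) (pt : ℤ → X) (hlen : ∀ a ∈ I, 1 ≤ len a)
    (hI : ∀ a ∈ I, ∀ b ∈ I, a < b → a + len a + p (len a) ≤ b) :
    ∃ z : X, ∀ a ∈ I, ∀ i < len a, dist (f^[i] (pt a)) (f^[i] (orb a z)) ≤
      ε * Real.exp (-(min ((i : ℝ) * l₁) (((len a : ℝ) - 1 - i) * l₂))) := by
  classical
  let K : I → Set X := fun a => {z | ∀ i < len a, dist (f^[i] (pt a)) (f^[i] (orb a z)) ≤
      ε * Real.exp (-(min ((i : ℝ) * l₁) (((len a : ℝ) - 1 - i) * l₂)))}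
  have hK : ∀ a, IsClosed (K a) := by
    intro a
    have : K a = ⋂ (i : ℕ) (_ : i < len a), {z | dist (f^[i] (pt a)) (f^[i] (orb a z)) ≤
      ε * Real.exp (-(min ((i : ℝ) * l₁) (((len a : ℝ) - 1 - i) * l₂)))} := by
      ext z; simp [K]
    rw [this]
    refine isClosed_iInter fun i => isClosed_iInter fun _ => isClosed_le ?_ continuous_const
    exact continuous_const.dist ((hf.iterate i).comp (ho.continuous a (hIW a.2)))
  have key : (Set.univ ∩ ⋂ a, K a).Nonempty := by
    -- A finite subfamily has an earliest time `a₀`. Shifted by `a₀` it lives at natural times, and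
    -- surjectivity of `orb a₀` moves the shadowing point back. Closedness of `K` is why the errors
    -- are non-strict.
    refine isCompact_univ.inter_iInter_nonempty K hK fun u => ?_
    obtain ⟨a₀, ha₀, hmin⟩ : ∃ a₀ ∈ W, ∀ a ∈ u, a₀ ≤ (a : ℤ) := by
      rcases u.eq_empty_or_nonempty with rfl | hu
      · exact ⟨0, by simpa using ho.natCast_mem 0, by simp⟩
      · obtain ⟨b, _, hb⟩ := u.exists_min_image (fun a => (a : ℤ)) hu
        exact ⟨b, hIW b.2, hb⟩
    obtain ⟨y, hy⟩ := hp.exists_of_finset hsurj (u.image fun a : I => ((a : ℤ) - a₀).toNat)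
      (fun b => len (a₀ + b)) (fun b => pt (a₀ + b))
      (by
        intro b hb
        obtain ⟨a, ha, rfl⟩ := Finset.mem_image.1 hb
        have h := hmin a ha
        have : a₀ + (((a : ℤ) - a₀).toNat : ℤ) = a := by omega
        rw [this]
        exact hlen _ a.2)
      (by
        intro b hb c hc hbc
        obtain ⟨a, ha, rfl⟩ := Finset.mem_image.1 hb
        obtain ⟨a', ha', rfl⟩ := Finset.mem_image.1 hc
        have h := hmin a ha
        have h' := hmin a' ha'
        have e1 : a₀ + (((a : ℤ) - a₀).toNat : ℤ) = a := by omega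
        rw [e1]
        have := hI a a.2 a' a'.2 (by omega)
        omega)
    obtain ⟨z, rfl⟩ := ho.surjective a₀ ha₀ y
    refine ⟨z, trivial, Set.mem_iInter₂.2 fun a ha i hi => ?_⟩
    have h := hmin a ha
    have e1 : a₀ + (((a : ℤ) - a₀).toNat : ℤ) = a := by omega
    have := hy _ (Finset.mem_image_of_mem _ ha)
    rw [← ho.orb_add a₀ ha₀, e1] at this
    exact (this i hi).le
  obtain ⟨z, _, hz⟩ := key
  exact ⟨z, fun a ha => Set.mem_iInter.1 hz ⟨a, ha⟩⟩

end ShrinkingTarget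

/-! ### Target times and free cells -/

namespace ShrinkingTarget

/-- A target of rate less than `r` is hit by a segment that starts `u` steps earlier and ends `v`
steps later, and the time before the segment dominates `ρ` times the time at its end. -/
theorem eventually_exists_target_segment {l₁ l₂ ε r ρ : ℝ} (hl₁ : 0 < l₁) (hl₂ : 0 < l₂)
    (hε : 0 < ε) {p : ℕ → ℕ} (hp : Tendsto (fun m : ℕ => (p m : ℝ) / m) atTop (𝓝 0))
    {φ : ℕ → ℝ} (hφ : ∀ n, 0 < φ n) (hr : 0 < r) (hφr : shrinkingRate φ < (r : EReal))
    (hρ : 0 ≤ ρ) (hρr : ρ < ratio l₁ l₂ r) (B : ℝ) :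
    ∀ᶠ t : ℕ in atTop, ∃ u v : ℕ,
      ε * Real.exp (-(min ((u : ℝ) * l₁) ((v : ℝ) * l₂))) < φ t ∧
      ρ * ((t + v + 1 + p (u + v + 1) : ℕ) : ℝ) + B + u ≤ t := by
  set c : ℝ := max (Real.log ε) 0
  set x := r / l₁ with hx
  set y := r / l₂ with hy
  have hx0 : 0 < x := by positivity
  have hy0 : 0 < y := by positivity
  -- The margin per unit of `t`: time `t` minus the lead `x t`, minus `ρ` times the end `(1 + y) t`.
  have hκ : 0 < 1 - x - ρ * (1 + y) := by
    have h1 : ratio l₁ l₂ r = (1 - x) / (1 + y) := by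
      rw [ratio, hx, hy]; field_simp
    rw [h1, lt_div_iff₀ (by positivity)] at hρr
    linarith
  set κ := 1 - x - ρ * (1 + y)
  -- Gaps at most `η` times the segment length cost at most half of the margin; `ρ + 1` keeps the
  -- denominator nonzero at `ρ = 0`.
  set η := κ / (2 * (ρ + 1) * (x + y)) with hη
  have hη0 : 0 < η := by positivity
  have hρη : ρ * η * (x + y) ≤ κ / 2 := by
    have : (ρ + 1) * η * (x + y) = κ / 2 := by rw [hη]; field_simp
    nlinarith [mul_pos hη0 (add_pos hx0 hy0)]
  have hpη : ∀ᶠ m : ℕ in atTop, (p m : ℝ) ≤ η * m := by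
    filter_upwards [hp.eventually_lt_const hη0, eventually_gt_atTop 0] with m hm hm0
    rw [div_lt_iff₀ (by exact_mod_cast hm0)] at hm
    exact hm.le
  obtain ⟨m₀, hm₀⟩ := eventually_atTop.1 hpη
  have hφ' : ∀ᶠ t : ℕ in atTop, ((-Real.log (φ t) / t : ℝ) : EReal) < (r : EReal) :=
    eventually_lt_of_limsup_lt hφr
  set u : ℕ → ℕ := fun t => ⌈(r * t + c) / l₁⌉₊ with hu
  set v : ℕ → ℕ := fun t => ⌈(r * t + c) / l₂⌉₊ with hv
  set D := ρ * (c / l₂ + 2 + η * (c / l₁ + c / l₂ + 3)) + B + c / l₁ + 1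
  have hc : 0 ≤ c := le_max_right _ _
  have hu1 : ∀ t : ℕ, x * t + c / l₁ ≤ u t := fun t => by
    have h := Nat.le_ceil ((r * t + c) / l₁)
    have h2 : (r * t + c) / l₁ = x * t + c / l₁ := by rw [hx]; field_simp
    rw [h2] at h; simpa [hu, h2] using h
  have hu2 : ∀ t : ℕ, (u t : ℝ) ≤ x * t + c / l₁ + 1 := fun t => by
    have h := (Nat.ceil_lt_add_one (a := (r * t + c) / l₁) (by positivity)).le
    have h2 : (r * t + c) / l₁ = x * t + c / l₁ := by rw [hx]; field_simp
    simpa [hu, h2] using h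
  have hv1 : ∀ t : ℕ, y * t + c / l₂ ≤ v t := fun t => by
    have h := Nat.le_ceil ((r * t + c) / l₂)
    have h2 : (r * t + c) / l₂ = y * t + c / l₂ := by rw [hy]; field_simp
    rw [h2] at h; simpa [hv, h2] using h
  have hv2 : ∀ t : ℕ, (v t : ℝ) ≤ y * t + c / l₂ + 1 := fun t => by
    have h := (Nat.ceil_lt_add_one (a := (r * t + c) / l₂) (by positivity)).le
    have h2 : (r * t + c) / l₂ = y * t + c / l₂ := by rw [hy]; field_simp
    simpa [hv, h2] using h
  have hbig : ∀ K : ℝ, ∀ᶠ t : ℕ in atTop, K ≤ (t : ℝ) := fun K =>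
    tendsto_natCast_atTop_atTop.eventually_ge_atTop K
  filter_upwards [hφ', eventually_gt_atTop 0, hbig (m₀ / x), hbig (D / (κ / 2))]
    with t h1 h0 h2 h3
  have ht : (0 : ℝ) < t := by exact_mod_cast h0
  refine ⟨u t, v t, ?_, ?_⟩
  · rw [EReal.coe_lt_coe_iff, div_lt_iff₀ ht] at h1
    have hmin : r * t + c ≤ min ((u t : ℝ) * l₁) ((v t : ℝ) * l₂) := by
      refine le_min ?_ ?_
      · have := mul_le_mul_of_nonneg_right (hu1 t) hl₁.le
        have h4 : (x * t + c / l₁) * l₁ = r * t + c := by rw [hx]; field_simp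
        linarith
      · have := mul_le_mul_of_nonneg_right (hv1 t) hl₂.le
        have h4 : (y * t + c / l₂) * l₂ = r * t + c := by rw [hy]; field_simp
        linarith
    have hlog : Real.log ε ≤ c := le_max_left _ _
    calc ε * Real.exp (-(min ((u t : ℝ) * l₁) ((v t : ℝ) * l₂)))
        = Real.exp (Real.log ε - min ((u t : ℝ) * l₁) ((v t : ℝ) * l₂)) := by
          rw [sub_eq_add_neg, Real.exp_add, Real.exp_log hε]
      _ < Real.exp (Real.log (φ t)) := Real.exp_lt_exp.2 (by linarith)
      _ = φ t := Real.exp_log (hφ t)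
  · have hm : m₀ ≤ u t + v t + 1 := by
      rw [div_le_iff₀ hx0] at h2
      have h5 : (m₀ : ℝ) ≤ u t := by
        have := hu1 t
        have : 0 ≤ c / l₁ := by positivity
        linarith
      have : m₀ ≤ u t := by exact_mod_cast h5
      omega
    have hpm := hm₀ _ hm
    rw [div_le_iff₀ (by positivity)] at h3
    push_cast at hpm ⊢
    have e1 : (p (u t + v t + 1) : ℝ) ≤ η * ((x + y) * t + (c / l₁ + c / l₂ + 3)) :=
      hpm.trans (mul_le_mul_of_nonneg_left (by linarith [hu2 t, hv2 t]) hη0.le)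
    have e2 : ρ * ((t : ℝ) + v t + 1 + p (u t + v t + 1)) ≤
        ρ * (t + (y * t + c / l₂ + 1) + 1 + η * ((x + y) * t + (c / l₁ + c / l₂ + 3))) :=
      mul_le_mul_of_nonneg_left (by linarith [hv2 t]) hρ
    have e3 : ρ * η * (x + y) * t ≤ κ / 2 * t := mul_le_mul_of_nonneg_right hρη ht.le
    have e4 : κ = 1 - x - ρ * (1 + y) := rfl
    have e5 : D = ρ * (c / l₂ + 2 + η * (c / l₁ + c / l₂ + 3)) + B + c / l₁ + 1 := rfl
    have e6 : κ * t = t - x * t - ρ * (1 + y) * t := by rw [e4]; ring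
    nlinarith [hu2 t]

/-- The `k`-th target is hit at time `t k`, by a segment with `u k` earlier and `v k` later steps;
`e (k + 1)` is the end of the gap after that segment. The index of the `k`-th target is
`k.unpair.1`, so that every target recurs. -/
structure IsSchedule (p : ℕ → ℕ) (s : ℕ → ℕ → ℕ) (φ : ℕ → ℕ → ℝ) (l₁ l₂ ε ρ : ℝ)
    (t u v e : ℕ → ℕ) : Prop where
  end_zero : e 0 = 0
  end_succ : ∀ k, e (k + 1) = t k + v k + 1 + p (u k + v k + 1)
  time_mem : ∀ k, t k ∈ Set.range (s k.unpair.1)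
  error_lt : ∀ k, ε * Real.exp (-(min ((u k : ℝ) * l₁) ((v k : ℝ) * l₂))) < φ k.unpair.1 (t k)
  end_le : ∀ k, ρ * (e (k + 1) : ℝ) + e k + u k ≤ t k

/-- Recursion on the end `B` of the previous window: since `s j` tends to infinity, a target time
can always be taken late enough to absorb `B`. -/
theorem exists_isSchedule {l₁ l₂ ε r ρ : ℝ} (hl₁ : 0 < l₁) (hl₂ : 0 < l₂)
    (hε : 0 < ε) {p : ℕ → ℕ} (hp : Tendsto (fun m : ℕ => (p m : ℝ) / m) atTop (𝓝 0))
    {φ : ℕ → ℕ → ℝ} (hφ : ∀ j n, 0 < φ j n) (hr : 0 < r)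
    (hφr : ∀ j, shrinkingRate (φ j) < (r : EReal)) (hρ : 0 ≤ ρ) (hρr : ρ < ratio l₁ l₂ r)
    {s : ℕ → ℕ → ℕ} (hs : ∀ j, Tendsto (s j) atTop atTop) :
    ∃ t u v e : ℕ → ℕ, IsSchedule p s φ l₁ l₂ ε ρ t u v e := by
  have key : ∀ j B : ℕ, ∃ t u v : ℕ, t ∈ Set.range (s j) ∧
      ε * Real.exp (-(min ((u : ℝ) * l₁) ((v : ℝ) * l₂))) < φ j t ∧
      ρ * ((t + v + 1 + p (u + v + 1) : ℕ) : ℝ) + B + u ≤ t := by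
    intro j B
    obtain ⟨i, u, v, h1, h2⟩ := ((hs j).eventually (eventually_exists_target_segment hl₁ hl₂ hε hp
      (hφ j) hr (hφr j) hρ hρr B)).exists
    exact ⟨s j i, u, v, ⟨i, rfl⟩, h1, h2⟩
  choose t u v ht herr hend using key
  let e : ℕ → ℕ := fun k => Nat.rec 0 (fun k B => t k.unpair.1 B + v k.unpair.1 B + 1 +
    p (u k.unpair.1 B + v k.unpair.1 B + 1)) k
  exact ⟨fun k => t k.unpair.1 (e k), fun k => u k.unpair.1 (e k), fun k => v k.unpair.1 (e k), e,
    rfl, fun k => rfl, fun k => ht _ _, fun k => herr _ _, fun k => hend _ _⟩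

/-- Cells of length `P` between two times. -/
theorem exists_cells_between (P x y : ℕ) (hP : 0 < P) :
    ∃ J : Finset ℤ, (∀ m ∈ J, (x : ℤ) ≤ m * P ∧ (m + 1) * P ≤ y) ∧
      (y : ℝ) - x - 2 * P ≤ J.card * P := by
  refine ⟨Finset.Ico ((x / P : ℕ) + 1 : ℤ) (y / P : ℕ), ?_, ?_⟩
  · intro m hm
    rw [Finset.mem_Ico] at hm
    have hx := Nat.div_add_mod x P
    have hx' := Nat.mod_lt x hP
    have hy := Nat.div_mul_le_self y P
    zify at hx hx' hy
    push_cast at hm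
    constructor
    · nlinarith
    · nlinarith
  · rw [Int.card_Ico]
    have h1 : ((y / P : ℕ) : ℤ) - ((x / P : ℕ) + 1 : ℤ) ≤
      (((y / P : ℕ) : ℤ) - ((x / P : ℕ) + 1 : ℤ)).toNat := Int.self_le_toNat _
    have h2 : ((y / P : ℕ) : ℝ) - ((x / P : ℕ) + 1 : ℝ) ≤
      ((((y / P : ℕ) : ℤ) - ((x / P : ℕ) + 1 : ℤ)).toNat : ℝ) := by exact_mod_cast h1
    have hy := Nat.div_add_mod y P
    have hy' := Nat.mod_lt y hP
    have hx := Nat.div_mul_le_self x P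
    have hy2 : (P : ℝ) * (y / P : ℕ) + (y % P : ℕ) = y := by exact_mod_cast hy
    have hy3 : ((y % P : ℕ) : ℝ) < P := by exact_mod_cast hy'
    have hx2 : ((x / P : ℕ) : ℝ) * P ≤ x := by exact_mod_cast hx
    have hPpos : (0 : ℝ) < P := by exact_mod_cast hP
    nlinarith [mul_le_mul_of_nonneg_right h2 hPpos.le]

/-- The cell `[m P, (m + 1) P)` meets none of the windows `[a k, e (k + 1))`. -/
def IsFreeCell (a e : ℕ → ℕ) (P : ℕ) (m : ℤ) : Prop :=
  ∀ k, (m + 1) * P ≤ a k ∨ (e (k + 1) : ℤ) ≤ m * P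

theorem isFreeCell_of_neg {a e : ℕ → ℕ} {P : ℕ} {m : ℤ} (hm : m < 0) : IsFreeCell a e P m := by
  refine fun k => Or.inl ?_
  have : (m + 1) * (P : ℤ) ≤ 0 := mul_nonpos_of_nonpos_of_nonneg (by omega) (by omega)
  omega

/-- Up to time `n` there are at least `ρ n / P - 4` free cells. -/
theorem exists_freeCells {a e : ℕ → ℕ} {ρ : ℝ} (hρ : 0 ≤ ρ) (he0 : e 0 = 0)
    (hae : ∀ k, a k < e (k + 1)) (h : ∀ k, ρ * (e (k + 1) : ℝ) + e k ≤ a k)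
    {P : ℕ} (hP : 0 < P) (n : ℕ) :
    ∃ J : Finset ℤ, (∀ m ∈ J, IsFreeCell a e P m ∧ 0 ≤ m ∧ (m + 1) * P ≤ n) ∧
      ρ * n - 4 * P ≤ J.card * P := by
  classical
  have hPpos : (0 : ℤ) < P := by exact_mod_cast hP
  have hea : ∀ k, e k ≤ a k := fun k => by
    have h1 := h k
    have : (0 : ℝ) ≤ ρ * e (k + 1) := by positivity
    have : (e k : ℝ) ≤ a k := by linarith
    exact_mod_cast this
  have hmono : StrictMono e := strictMono_nat_of_lt_succ fun k => (hea k).trans_lt (hae k)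
  -- Needed when `n` falls in a free stretch: `ρ * e k + (n - e k) ≥ ρ * n`.
  have hρ1 : ρ ≤ 1 := by
    have h1 := h 0
    have h2 : (a 0 : ℝ) < e (0 + 1) := by exact_mod_cast hae 0
    rw [he0] at h1
    by_contra! hcon
    have : (e (0 + 1) : ℝ) ≤ ρ * e (0 + 1) := by
      nlinarith [Nat.cast_nonneg (α := ℝ) (e (0 + 1))]
    push_cast at h1
    linarith
  have hamono : Monotone a := monotone_nat_of_le_succ fun k => (hae k).le.trans (hea _)
  have hfree : ∀ k m, (e k : ℤ) ≤ m * P → (m + 1) * P ≤ (a k : ℤ) → IsFreeCell a e P m := by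
    intro k m h1 h2 i
    rcases lt_or_ge i k with hi | hi
    · right
      have : e (i + 1) ≤ e k := hmono.monotone hi
      omega
    · left
      have : a k ≤ a i := hamono hi
      omega
  have hnonneg : ∀ (x : ℕ) (m : ℤ), (x : ℤ) ≤ m * P → 0 ≤ m := fun x m hx => by
    by_contra! hm
    nlinarith
  -- The last free stretch before `e k` alone supplies the required number of cells; earlier ones
  -- are discarded.
  have hprev : ∀ k, ∃ J : Finset ℤ, (∀ m ∈ J, IsFreeCell a e P m ∧ 0 ≤ m ∧ (m + 1) * P ≤ e k) ∧
      ρ * e k - 2 * P ≤ J.card * P := by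
    intro k
    cases k with
    | zero => exact ⟨∅, by simp, by simp [he0]⟩
    | succ k =>
      obtain ⟨J, hJ, hc⟩ := exists_cells_between P (e k) (a k) hP
      refine ⟨J, fun m hm => ⟨hfree k m (hJ m hm).1 (hJ m hm).2, hnonneg _ m (hJ m hm).1, ?_⟩, ?_⟩
      · have := (hJ m hm).2
        have := hae k
        omega
      · linarith [h k]
  obtain ⟨k, hk1, hk2⟩ : ∃ k, e k ≤ n ∧ n < e (k + 1) := by
    have hex : ∃ k, n < e k := ⟨n + 1, hmono.le_apply⟩
    have h1 := Nat.find_spec hex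
    have h0 : Nat.find hex ≠ 0 := by
      intro h0
      rw [h0, he0] at h1
      omega
    refine ⟨Nat.find hex - 1, ?_, ?_⟩
    · exact not_lt.1 (Nat.find_min hex (by omega))
    · rwa [Nat.sub_add_cancel (by omega)]
  obtain ⟨J₁, hJ₁, hc₁⟩ := hprev k
  obtain ⟨J₂, hJ₂, hc₂⟩ := exists_cells_between P (e k) (min n (a k)) hP
  have hdisj : Disjoint J₁ J₂ := by
    rw [Finset.disjoint_left]
    intro m h1 h2
    have := (hJ₁ m h1).2.2
    have := (hJ₂ m h2).1
    nlinarith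
  refine ⟨J₁ ∪ J₂, ?_, ?_⟩
  · intro m hm
    rcases Finset.mem_union.1 hm with hm | hm
    · refine ⟨(hJ₁ m hm).1, (hJ₁ m hm).2.1, ?_⟩
      have := (hJ₁ m hm).2.2
      omega
    · have h1 := (hJ₂ m hm).2
      exact ⟨hfree k m (hJ₂ m hm).1 (by omega), hnonneg _ m (hJ₂ m hm).1, by omega⟩
  · rw [Finset.card_union_of_disjoint hdisj]
    push_cast
    have hk1' : (e k : ℝ) ≤ n := by exact_mod_cast hk1
    have hk2' : (n : ℝ) < e (k + 1) := by exact_mod_cast hk2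
    rcases le_total n (a k) with hna | hna
    · rw [min_eq_left hna] at hc₂
      nlinarith
    · rw [min_eq_right hna] at hc₂
      have := h k
      have : 0 ≤ ρ * e k := by positivity
      nlinarith

end ShrinkingTarget

/-! ### Separated alphabets and the coding -/

namespace ShrinkingTarget

variable {X : Type*} [MetricSpace X]

/-- Large separated sets exist, at one scale, for arbitrarily long times. -/
theorem exists_frequently_separated {f : X → X} {y : ℝ}
    (hy : (y : EReal) < Dynamics.coverEntropy f Set.univ) :
    ∃ δ > 0, ∃ᶠ n : ℕ in atTop, ∃ A : Finset X, Real.exp (y * n) ≤ A.card ∧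
      ∀ a ∈ A, ∀ b ∈ A, a ≠ b → ∃ i < n, δ ≤ dist (f^[i] a) (f^[i] b) := by
  obtain ⟨y', hyy', hy'⟩ := EReal.lt_iff_exists_real_btwn.1 hy
  rw [EReal.coe_lt_coe_iff] at hyy'
  rw [Dynamics.coverEntropy_eq_iSup_basis_netEntropyEntourage Metric.uniformity_basis_dist,
    lt_iSup_iff] at hy'
  obtain ⟨δ, hy'⟩ := hy'
  rw [lt_iSup_iff] at hy'
  obtain ⟨hδ, hy'⟩ := hy'
  refine ⟨δ, hδ, ?_⟩
  have hfreq := ExpGrowth.frequently_exp_le hy'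
  refine (hfreq.and_eventually (eventually_gt_atTop 0)).mono ?_
  rintro n ⟨hn, hn0⟩
  obtain ⟨A, hA, hcard⟩ : ∃ A : Finset X,
      Dynamics.IsDynNetIn f Set.univ {q : X × X | dist q.1 q.2 < δ} n A ∧
        Real.exp (y * n) ≤ A.card := by
    by_contra! hcon
    have h1 : Dynamics.netMaxcard f Set.univ {q : X × X | dist q.1 q.2 < δ} n ≤
        (⌊Real.exp (y * n)⌋₊ : ℕ∞) :=
      iSup₂_le fun A hA => by exact_mod_cast Nat.le_floor (hcon A hA).le
    have h2 : EReal.exp ((y' : EReal) * n) ≤ ((⌊Real.exp (y * n)⌋₊ : ℕ∞) : ℝ≥0∞) :=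
      hn.trans (ENat.toENNReal_mono h1)
    have h3 : (y' : EReal) * (n : EReal) = ((y' * n : ℝ) : EReal) := by
      push_cast
      rfl
    rw [h3, EReal.exp_coe, ENat.toENNReal_coe, ← ENNReal.ofReal_natCast,
      ENNReal.ofReal_le_ofReal_iff (by positivity)] at h2
    have h4 := h2.trans (Nat.floor_le (Real.exp_pos (y * n)).le)
    rw [Real.exp_le_exp] at h4
    have : (0 : ℝ) < n := by exact_mod_cast hn0
    nlinarith
  refine ⟨A, hcard, fun a ha b hb hab => ?_⟩
  by_contra! hcon
  have hdisj := hA.2 ha hb hab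
  have h1 : (a, b) ∈ Dynamics.dynEntourage f {q : X × X | dist q.1 q.2 < δ} n :=
    Dynamics.mem_dynEntourage.2 hcon
  have h2 : (b, b) ∈ Dynamics.dynEntourage f {q : X × X | dist q.1 q.2 < δ} n :=
    Dynamics.mem_dynEntourage.2 fun k _ => by simpa using hδ
  exact Set.disjoint_left.1 hdisj h1 h2

/-- An alphabet `A` of points that are `δ`-separated during the middle part of blocks of length
`N + 2 * c`, at a part of the block where shadowing is `δ / 4`-precise. -/
theorem exists_alphabet {f : X → X} {l₁ l₂ ε y : ℝ} (hl₁ : 0 < l₁) (hl₂ : 0 < l₂)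
    {p : ℕ → ℕ} (hp : Tendsto (fun m : ℕ => (p m : ℝ) / m) atTop (𝓝 0))
    (hy : (y : EReal) < Dynamics.coverEntropy f Set.univ) :
    ∃ (A : Finset X) (N c : ℕ) (δ : ℝ), A.Nonempty ∧ 0 < N ∧ 0 < δ ∧
      ε * Real.exp (-(c * min l₁ l₂)) ≤ δ / 4 ∧
      Real.exp (y * ((N + 2 * c + p (N + 2 * c) : ℕ) : ℝ)) ≤ A.card ∧
      ∀ a ∈ A, ∀ b ∈ A, a ≠ b → ∃ i < N, δ ≤ dist (f^[i] a) (f^[i] b) := by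
  obtain ⟨y', hyy', hy'⟩ := EReal.lt_iff_exists_real_btwn.1 hy
  rw [EReal.coe_lt_coe_iff] at hyy'
  obtain ⟨δ, hδ, hfreq⟩ := exists_frequently_separated hy'
  have hl : 0 < min l₁ l₂ := lt_min hl₁ hl₂
  obtain ⟨c, hc⟩ : ∃ c : ℕ, ε * Real.exp (-(c * min l₁ l₂)) ≤ δ / 4 := by
    have h1 : Tendsto (fun c : ℕ => ε * Real.exp (-(c * min l₁ l₂))) atTop (𝓝 (ε * 0)) :=
      (Real.tendsto_exp_neg_atTop_nhds_zero.comp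
        (tendsto_natCast_atTop_atTop.atTop_mul_const hl)).const_mul ε
    rw [mul_zero] at h1
    exact (h1.eventually_le_const (by positivity)).exists
  -- The gap `y' - y` pays for the margins `2 * c` and the shadowing gap. Negative `y` only needs a
  -- nonempty alphabet; this case yields nonemptiness of the target set even at zero entropy.
  have hlen : ∀ᶠ N : ℕ in atTop, 0 ≤ y →
      y * ((N + 2 * c + p (N + 2 * c) : ℕ) : ℝ) ≤ y' * N := by
    by_cases hy0 : 0 ≤ y
    swap
    · exact Eventually.of_forall fun N h => absurd h hy0
    set η := (y' - y) / (2 * (y + 1)) with hη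
    have hη0 : 0 < η := div_pos (by linarith) (by linarith)
    have hyη : y * η ≤ (y' - y) / 2 := by
      have : (y + 1) * η = (y' - y) / 2 := by rw [hη]; field_simp
      nlinarith
    have h1 : ∀ᶠ N : ℕ in atTop, (p (N + 2 * c) : ℝ) / (N + 2 * c : ℕ) < η :=
      (tendsto_add_atTop_nat (2 * c)).eventually (hp.eventually_lt_const hη0)
    have h2 : ∀ᶠ N : ℕ in atTop, y * (1 + η) * (2 * c) / ((y' - y) / 2) ≤ (N : ℝ) :=
      tendsto_natCast_atTop_atTop.eventually_ge_atTop _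
    filter_upwards [h1, h2, eventually_gt_atTop 0] with N h1 h2 h3 _
    have hN : (0 : ℝ) < N := by exact_mod_cast h3
    rw [div_lt_iff₀ (by exact_mod_cast (by omega : 0 < N + 2 * c))] at h1
    rw [div_le_iff₀ (by linarith)] at h2
    push_cast at h1 ⊢
    have h4 := mul_le_mul_of_nonneg_left h1.le hy0
    nlinarith
  obtain ⟨N, ⟨A, hcard, hA⟩, hN, hN0⟩ :=
    (hfreq.and_eventually (hlen.and (eventually_gt_atTop 0))).exists
  have hA0 : 0 < A.card := by
    have := (Real.exp_pos _).trans_le hcard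
    exact_mod_cast this
  refine ⟨A, N, c, δ, Finset.card_pos.1 hA0, hN0, hδ, hc, ?_, hA⟩
  rcases le_or_gt 0 y with hy0 | hy0
  · exact (Real.exp_le_exp.2 (hN hy0)).trans hcard
  · have h1 : (1 : ℝ) ≤ A.card := by exact_mod_cast hA0
    refine le_trans (Real.exp_le_one_iff.2 ?_) h1
    exact mul_nonpos_of_nonpos_of_nonneg hy0.le (Nat.cast_nonneg _)

theorem exists_ratio_gt {l₁ l₂ τ ρ : ℝ} (hl₁ : 0 < l₁) (hl₂ : 0 < l₂) (hτ : 0 ≤ τ)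
    (hρ : ρ < ratio l₁ l₂ τ) : ∃ r, τ < r ∧ ρ < ratio l₁ l₂ r := by
  have hc : ContinuousAt (ratio l₁ l₂) τ := by
    unfold ratio
    refine ContinuousAt.div (by fun_prop) (by fun_prop) ?_
    positivity
  have h1 : ∀ᶠ r in 𝓝[>] τ, ρ < ratio l₁ l₂ r :=
    (hc.eventually (lt_mem_nhds hρ)).filter_mono nhdsWithin_le_nhds
  obtain ⟨r, h2, h3⟩ := (h1.and self_mem_nhdsWithin).exists
  exact ⟨r, h3, h2⟩

theorem shrinkingRate_nonneg {φ : ℕ → ℝ} (hφ : ∀ n, 0 < φ n ∧ φ n ≤ 1) :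
    0 ≤ shrinkingRate φ := by
  refine le_limsup_of_frequently_le (Frequently.of_forall fun n => ?_)
  have : 0 ≤ -Real.log (φ n) / n :=
    div_nonneg (neg_nonneg.2 (Real.log_nonpos (hφ n).1.le (hφ n).2)) (Nat.cast_nonneg n)
  exact_mod_cast this

/-- A coding of part of `E` by the sequences in the alphabet `A`: in each free cell `m` of length
`P` inside the window `W`, points with different `m`-th letters are `δ`-separated. -/
structure IsCoding (f : X → X) (W : Set ℤ) (orb : ℤ → X → X) (E : Set X) (y ρ : ℝ)
    (A : Finset X) (P : ℕ) (δ : ℝ) (Fr : Set ℤ) (code : (ℤ → A) → X) : Prop where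
  nonempty : A.Nonempty
  period_pos : 0 < P
  scale_pos : 0 < δ
  exp_le_card : Real.exp (y * P) ≤ A.card
  mem : ∀ ω, code ω ∈ E
  free_of_neg : ∀ m < 0, m ∈ Fr
  exists_free : ∀ n : ℕ, ∃ J : Finset ℤ, (∀ m ∈ J, m ∈ Fr ∧ 0 ≤ m ∧ (m + 1) * P ≤ n) ∧
    ρ * n - 4 * P ≤ J.card * P
  separated : ∀ m ∈ Fr, m * P ∈ W → ∀ ω ω', ω m ≠ ω' m → ∃ i < P,
    δ ≤ dist (f^[i] (orb (m * P) (code ω))) (f^[i] (orb (m * P) (code ω')))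

/-- One family of segments serves both purposes: those starting at `a k` are fixed and hit the
targets, those starting free cells carry the letters. Both end, with their gaps, before the next one
starts. -/
theorem OrbitWindow.exists_isCoding [CompactSpace X] {f : X → X} {W : Set ℤ} {orb : ℤ → X → X}
    (ho : OrbitWindow f W orb) (hf : Continuous f) (hsurj : Function.Surjective f)
    {l₁ l₂ ε : ℝ} (hl₁ : 0 < l₁) (hl₂ : 0 < l₂) (hε : 0 < ε)
    (hspec : ExpNonuniformSpecification f l₁ l₂ ε)
    {φ : ℕ → ℕ → ℝ} (hφ : ∀ j n, 0 < φ j n ∧ φ j n ≤ 1) (z : ℕ → ℕ → X)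
    {s : ℕ → ℕ → ℕ} (hs : ∀ j, Tendsto (s j) atTop atTop)
    {τ : EReal} (hτ : τ = ⨆ j, shrinkingRate (φ j)) (hτl : τ < (l₁ : EReal))
    {ρ y : ℝ} (hρ : 0 ≤ ρ) (hρτ : ρ < ratio l₁ l₂ τ.toReal)
    (hy : (y : EReal) < Dynamics.coverEntropy f Set.univ) :
    ∃ A P δ Fr code,
      IsCoding f W orb (⋂ j, targetSet f (φ j) (z j) (Set.range (s j))) y ρ A P δ Fr code := by
  classical
  obtain ⟨p, -, hp0, hp⟩ := hspec
  replace hp : IsShadowingGap f l₁ l₂ ε p := hp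
  have hτj : ∀ j, shrinkingRate (φ j) ≤ τ := fun j => hτ ▸ le_iSup (fun j => shrinkingRate (φ j)) j
  have hτ0 : 0 ≤ τ := (shrinkingRate_nonneg (hφ 0)).trans (hτj 0)
  have hτcoe : (τ.toReal : EReal) = τ :=
    EReal.coe_toReal (ne_top_of_lt hτl) (ne_bot_of_le_ne_bot (by simp) hτ0)
  obtain ⟨r, hτr, hρr⟩ := exists_ratio_gt hl₁ hl₂ (EReal.toReal_nonneg hτ0) hρτ
  have hr : 0 < r := (EReal.toReal_nonneg hτ0).trans_lt hτr
  obtain ⟨t, u, v, e, hsch⟩ := exists_isSchedule hl₁ hl₂ hε hp0 (fun j n => (hφ j n).1) hr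
    (fun j => (hτj j).trans_lt (by rw [← hτcoe]; exact_mod_cast hτr)) hρ hρr hs
  obtain ⟨A, N, c, δ, hA, hN, hδ, hc, hcard, hsep⟩ := exists_alphabet (ε := ε) hl₁ hl₂ hp0 hy
  have hut : ∀ k, e k + u k ≤ t k := fun k => by
    have h1 := hsch.end_le k
    have h2 : 0 ≤ ρ * (e (k + 1) : ℝ) := by positivity
    have : (e k : ℝ) + u k ≤ t k := by linarith
    exact_mod_cast this
  set len := N + 2 * c with hlen
  set P := len + p len with hP
  let a : ℕ → ℕ := fun k => t k - u k
  have hae : ∀ k, a k + (u k + v k + 1) + p (u k + v k + 1) = e (k + 1) := fun k => by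
    have h1 := hut k
    have h2 := hsch.end_succ k
    simp only [a]
    omega
  have hea : ∀ k, e k ≤ a k := fun k => by
    have h1 := hut k
    simp only [a]
    omega
  have hemono : StrictMono e := strictMono_nat_of_lt_succ fun k => by
    have := hea k
    have := hae k
    omega
  have hamono : StrictMono a := strictMono_nat_of_lt_succ fun k => by
    have := hea (k + 1)
    have := hae k
    omega
  have hρa : ∀ k, ρ * (e (k + 1) : ℝ) + e k ≤ a k := fun k => by
    have h1 := hsch.end_le k
    have h2 : ((t k - u k : ℕ) : ℝ) = t k - u k := Nat.cast_sub (by have := hut k; omega)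
    simp only [a, h2]
    linarith
  have hP0 : 0 < P := by omega
  have hPZ : (0 : ℤ) < P := by exact_mod_cast hP0
  -- Preimages align the segments: a letter is reached `c` steps into its cell, a target `u k` steps
  -- into its window.
  choose g hg using hsurj.iterate c
  choose w hw using fun k => hsurj.iterate (u k) (z k.unpair.1 (t k))
  let Fr : Set ℤ := {m | IsFreeCell a e P m}
  let T : Set ℤ := Set.range fun k => (a k : ℤ)
  let I : Set ℤ := {b | ∃ m ∈ Fr, m * P ∈ W ∧ b = m * P} ∪ T
  let idx : ℤ → ℕ := Function.invFun fun k => (a k : ℤ)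
  have hidx : ∀ k, idx (a k) = k := Function.leftInverse_invFun
    (fun k l h => hamono.injective (by exact_mod_cast h))
  let L : ℤ → ℕ := fun b => if b ∈ T then u (idx b) + v (idx b) + 1 else len
  let pt : (ℤ → A) → ℤ → X := fun ω b => if b ∈ T then w (idx b) else g (ω (b / P))
  have hLT : ∀ k, L (a k) = u k + v k + 1 := fun k => by
    simp only [L]
    rw [if_pos ⟨k, rfl⟩, hidx]
  have hptT : ∀ ω k, pt ω (a k) = w k := fun ω k => by
    simp only [pt]
    rw [if_pos ⟨k, rfl⟩, hidx]
  have hnotT : ∀ m ∈ Fr, m * (P : ℤ) ∉ T := by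
    rintro m hm ⟨k, hk⟩
    have h1 := hae k
    rcases hm k with h | h
    · dsimp only at hk
      rw [hk] at h
      nlinarith
    · dsimp only at hk
      omega
  have hLF : ∀ m ∈ Fr, L (m * P) = len := fun m hm => if_neg (hnotT m hm)
  have hptF : ∀ ω, ∀ m ∈ Fr, pt ω (m * P) = g (ω m) := fun ω m hm => by
    simp only [pt]
    rw [if_neg (hnotT m hm), Int.mul_ediv_cancel _ hPZ.ne']
  have hIW : I ⊆ W := by
    rintro b (⟨m, _, hm, rfl⟩ | ⟨k, rfl⟩)
    · exact hm
    · exact ho.natCast_mem _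
  have hL1 : ∀ b ∈ I, 1 ≤ L b := by
    rintro b (⟨m, hm, _, rfl⟩ | ⟨k, rfl⟩)
    · rw [hLF m hm]; omega
    · dsimp only
      rw [hLT]; omega
  have hIsep : ∀ b ∈ I, ∀ b' ∈ I, b < b' → b + L b + p (L b) ≤ b' := by
    rintro b (⟨m, hm, _, rfl⟩ | ⟨k, rfl⟩) b' (⟨m', hm', _, rfl⟩ | ⟨k', rfl⟩) hbb'
    · rw [hLF m hm]
      have h1 : m < m' := lt_of_mul_lt_mul_right hbb' hPZ.le
      have h2 : (m + 1) * (P : ℤ) ≤ m' * P := mul_le_mul_of_nonneg_right h1 hPZ.le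
      have h3 : (m + 1) * (P : ℤ) = m * P + len + p len := by rw [hP]; push_cast; ring
      omega
    · rw [hLF m hm]
      dsimp only at hbb' ⊢
      have h3 : (m + 1) * (P : ℤ) = m * P + len + p len := by rw [hP]; push_cast; ring
      have h1 := hae k'
      rcases hm k' with h | h <;> omega
    · dsimp only at hbb' ⊢
      rw [hLT]
      have h1 := hae k
      rcases hm' k with h | h
      · nlinarith
      · omega
    · dsimp only at hbb' ⊢
      rw [hLT]
      have h1 := hae k
      have h2 : k < k' := hamono.lt_iff_lt.1 (by exact_mod_cast hbb')
      have h3 : e (k + 1) ≤ e k' := hemono.monotone h2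
      have h4 := hea k'
      omega
  choose code hcode using fun ω =>
    ho.exists_shadowing hf hsurj hp I hIW L (pt ω) hL1 hIsep
  -- Two shadowing errors of `δ / 4` reduce the separation from `δ` to `δ / 2`.
  refine ⟨A, P, δ / 2, Fr, code, hA, hP0, by positivity, hcard, ?_, fun m hm =>
    isFreeCell_of_neg hm, exists_freeCells hρ hsch.end_zero (fun k => by have := hae k; omega)
    hρa hP0, ?_⟩
  · refine fun ω => Set.mem_iInter.2 fun j => Set.infinite_of_forall_exists_gt fun b => ?_
    -- This index has target `j` and exceeds `b`; hence so does `t k ≥ e k ≥ k`.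
    set k := Nat.pair j (b + 1) with hk
    have hkj : k.unpair.1 = j := by simp [hk]
    have h1 := hcode ω (a k) (Or.inr ⟨k, rfl⟩) (u k) (by rw [hLT]; omega)
    rw [hptT, hw, ho.orb_natCast, ← Function.iterate_add_apply, hLT] at h1
    have h2 : u k + a k = t k := by
      have := hut k
      simp only [a]
      omega
    have h3 : (((u k + v k + 1 : ℕ) : ℝ) - 1 - u k) = v k := by push_cast; ring
    rw [h2, h3, dist_comm] at h1
    have h4 := h1.trans_lt (hsch.error_lt k)
    have h5 := hsch.time_mem k
    rw [hkj] at h4 h5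
    refine ⟨t k, ⟨h5, h4⟩, ?_⟩
    have h6 : b + 1 ≤ k := Nat.right_le_pair _ _
    have h7 : k ≤ e k := hemono.le_apply
    have h8 := hut k
    omega
  · intro m hm hmW ω ω' hne
    obtain ⟨i, hi, hd⟩ := hsep _ (ω m).2 _ (ω' m).2 (fun h => hne (Subtype.ext h))
    have key : ∀ ω : ℤ → A, dist (f^[i] (ω m)) (f^[i + c] (orb (m * P) (code ω))) ≤ δ / 4 := by
      intro ω
      have h1 := hcode ω (m * P) (Or.inl ⟨m, hm, hmW, rfl⟩) (i + c) (by rw [hLF m hm]; omega)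
      rw [hptF ω m hm, Function.iterate_add_apply f i c (g _), hg, hLF m hm] at h1
      refine h1.trans (le_trans ?_ hc)
      -- Time `i + c` is at least `c` steps away from both ends of the segment.
      refine mul_le_mul_of_nonneg_left (Real.exp_le_exp.2 (neg_le_neg (le_min ?_ ?_))) hε.le
      · push_cast
        exact mul_le_mul (by linarith [Nat.cast_nonneg (α := ℝ) i]) (min_le_left _ _)
          (lt_min hl₁ hl₂).le (by positivity)
      · have h2 : (i : ℝ) + 1 ≤ N := by exact_mod_cast hi
        have h3 : (c : ℝ) ≤ (len : ℝ) - 1 - ((i + c : ℕ) : ℝ) := by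
          rw [hlen]; push_cast; linarith
        exact mul_le_mul h3 (min_le_right _ _) (lt_min hl₁ hl₂).le
          (le_trans (Nat.cast_nonneg c) h3)
    refine ⟨i + c, by omega, ?_⟩
    have h1 := key ω
    have h2 := key ω'
    have h3 := dist_triangle4 (f^[i] (ω m : X)) (f^[i + c] (orb (m * P) (code ω)))
      (f^[i + c] (orb (m * P) (code ω'))) (f^[i] (ω' m : X))
    rw [dist_comm (f^[i + c] (orb (m * P) (code ω'))) (f^[i] (ω' m : X))] at h3
    linarith

end ShrinkingTarget

/-! ### Mass distribution principles -/

namespace ShrinkingTarget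

open MeasureTheory

/-- The uniform product measure on `ι → A`, transported by an arbitrary map as an outer measure. -/
theorem exists_outerMeasure_of_code {X ι A : Type*} [Fintype A] [Nonempty A]
    (code : (ι → A) → X) :
    ∃ ν : OuterMeasure X, (∀ E : Set X, (∀ ω, code ω ∈ E) → ν E = 1) ∧
      ∀ (U : Set X) (J : Finset ι),
        (∀ ω ω', code ω ∈ U → code ω' ∈ U → ∀ m ∈ J, ω m = ω' m) →
        ν U ≤ ((Fintype.card A : ℝ≥0∞)⁻¹) ^ J.card := by
  let _ : MeasurableSpace A := ⊤
  let μ : Measure (ι → A) := Measure.infinitePi fun _ : ι => (PMF.uniformOfFintype A).toMeasure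
  -- The code comes from choice and need not be measurable, hence an outer measure; only cylinders
  -- are evaluated.
  refine ⟨OuterMeasure.map code μ.toOuterMeasure, fun E hE => ?_, fun U J hU => ?_⟩
  · rw [OuterMeasure.map_apply, Set.preimage_eq_univ_iff.2 (by rintro _ ⟨ω, rfl⟩; exact hE ω)]
    exact measure_univ
  · rw [OuterMeasure.map_apply]
    rcases (code ⁻¹' U).eq_empty_or_nonempty with h | ⟨ω₀, h₀⟩
    · rw [h]; simp
    · have hsub : code ⁻¹' U ⊆ Set.pi J fun m => {ω₀ m} := fun ω hω m hm => hU ω ω₀ hω h₀ m hm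
      refine (measure_mono hsub).trans_eq ?_
      change μ _ = _
      rw [Measure.infinitePi_pi _ fun _ _ => MeasurableSet.singleton _]
      simp_rw [PMF.toMeasure_apply_singleton _ _ (MeasurableSet.singleton _),
        PMF.uniformOfFintype_apply, Finset.prod_const]

variable {X : Type*} [MetricSpace X]

/-- The mass distribution carried by a coding: sets whose points stay `δ`-close during the times
`[-n₁, n₂)` are small. -/
theorem IsCoding.exists_outerMeasure {f : X → X} {W : Set ℤ} {orb : ℤ → X → X}
    (ho : OrbitWindow f W orb) {E : Set X} {y ρ : ℝ} (hy : 0 ≤ y) {A : Finset X} {P : ℕ} {δ : ℝ}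
    {Fr : Set ℤ} {code : (ℤ → A) → X} (hc : IsCoding f W orb E y ρ A P δ Fr code) :
    ∃ (ν : OuterMeasure X) (C : ℝ), 0 < C ∧ ν E = 1 ∧
      ∀ (n₁ n₂ : ℕ) (U : Set X), (∀ a : ℤ, -(n₁ : ℤ) ≤ a → a ∈ W) →
        (∀ x ∈ U, ∀ x' ∈ U, ∀ a : ℤ, -(n₁ : ℤ) ≤ a → a < n₂ →
          dist (orb a x) (orb a x') < δ) →
        ν U ≤ ENNReal.ofReal (C * Real.exp (-(y * (ρ * n₂ + n₁)))) := by
  classical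
  have : Nonempty A := hc.nonempty.to_subtype
  obtain ⟨ν, hν1, hν⟩ := exists_outerMeasure_of_code code
  -- Rounding to cells loses `4 * P` in the future and `P` in the past.
  refine ⟨ν, Real.exp (y * (5 * P)), Real.exp_pos _, hν1 E hc.mem, fun n₁ n₂ U hW hU => ?_⟩
  have hP : (0 : ℤ) < P := by exact_mod_cast hc.period_pos
  obtain ⟨J₂, hJ₂, hcard₂⟩ := hc.exists_free n₂
  set J₁ : Finset ℤ := Finset.Ico (-((n₁ / P : ℕ) : ℤ)) 0 with hJ₁
  have hdisj : Disjoint J₁ J₂ := by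
    rw [Finset.disjoint_left]
    intro m h1 h2
    have := (hJ₂ m h2).2.1
    have := (Finset.mem_Ico.1 h1).2
    omega
  have hcard₁ : (n₁ : ℝ) - P ≤ J₁.card * P := by
    have h1 : J₁.card = n₁ / P := by
      rw [hJ₁, Int.card_Ico, zero_sub, neg_neg, Int.toNat_natCast]
    rw [h1]
    have h2 := Nat.div_add_mod n₁ P
    have h3 := Nat.mod_lt n₁ hc.period_pos
    have h4 : (P : ℝ) * (n₁ / P : ℕ) + (n₁ % P : ℕ) = n₁ := by exact_mod_cast h2
    have h5 : ((n₁ % P : ℕ) : ℝ) < P := by exact_mod_cast h3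
    linarith
  have hJ : ∀ m ∈ J₁ ∪ J₂, m ∈ Fr ∧ -(n₁ : ℤ) ≤ m * P ∧ (m + 1) * P ≤ n₂ := by
    intro m hm
    rcases Finset.mem_union.1 hm with hm | hm
    · obtain ⟨h1, h2⟩ := Finset.mem_Ico.1 hm
      refine ⟨hc.free_of_neg m h2, ?_, ?_⟩
      · have h3 := Nat.div_mul_le_self n₁ P
        zify at h3
        push_cast at h1
        nlinarith
      · have : (m + 1) * (P : ℤ) ≤ 0 := mul_nonpos_of_nonpos_of_nonneg (by omega) hP.le
        omega
    · obtain ⟨h1, h2, h3⟩ := hJ₂ m hm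
      refine ⟨h1, ?_, h3⟩
      have := mul_nonneg h2 hP.le
      omega
  refine (hν U (J₁ ∪ J₂) fun ω ω' h h' m hm => ?_).trans ?_
  · obtain ⟨h1, h2, h3⟩ := hJ m hm
    by_contra hne
    obtain ⟨i, hi, hd⟩ := hc.separated m h1 (hW _ h2) ω ω' hne
    rw [← ho.orb_add _ (hW _ h2), ← ho.orb_add _ (hW _ h2)] at hd
    refine absurd (hU _ h _ h' (m * P + i) (by omega) ?_) (not_lt.2 hd)
    have : (m + 1) * (P : ℤ) = m * P + P := by ring
    omega
  · have hA : (0 : ℝ) < A.card := by exact_mod_cast Finset.card_pos.2 hc.nonempty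
    have h1 : ((Fintype.card A : ℝ≥0∞)⁻¹) ^ (J₁ ∪ J₂).card =
        ENNReal.ofReal (((A.card : ℝ)⁻¹) ^ (J₁ ∪ J₂).card) := by
      rw [ENNReal.ofReal_pow (by positivity), ENNReal.ofReal_inv_of_pos hA,
        ENNReal.ofReal_natCast, Fintype.card_coe]
    rw [h1]
    refine ENNReal.ofReal_le_ofReal ?_
    have h2 : (A.card : ℝ)⁻¹ ≤ Real.exp (-(y * P)) := by
      rw [Real.exp_neg]
      exact inv_anti₀ (Real.exp_pos _) hc.exp_le_card
    calc ((A.card : ℝ)⁻¹) ^ (J₁ ∪ J₂).card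
        ≤ Real.exp (-(y * P)) ^ (J₁ ∪ J₂).card := pow_le_pow_left₀ (by positivity) h2 _
      _ = Real.exp ((J₁ ∪ J₂).card * -(y * P)) := (Real.exp_nat_mul _ _).symm
      _ ≤ Real.exp (y * (5 * P) + -(y * (ρ * n₂ + n₁))) := by
          rw [Real.exp_le_exp, Finset.card_union_of_disjoint hdisj]
          push_cast
          have h3 : ρ * n₂ + n₁ - 5 * P ≤ (J₁.card + J₂.card) * (P : ℝ) := by linarith
          have h4 := mul_le_mul_of_nonneg_left h3 hy
          linarith
      _ = _ := Real.exp_add _ _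

/-- Mass distribution principle for the Bowen entropy. -/
theorem le_bowenEntropy_of_outerMeasure {f : X → X} {E : Set X} {ν : OuterMeasure X}
    (hν : ν E = 1) {C σ ε : ℝ} (hC : 0 < C) (hε : 0 < ε)
    (h : ∀ (n : ℕ) (x : X), ν (bowenBall f n x ε) ≤ ENNReal.ofReal (C * Real.exp (-(σ * n)))) :
    ENNReal.ofReal σ ≤ bowenEntropy f E := by
  refine le_trans ?_ (le_iSup₂ (f := fun ε (_ : 0 < ε) => bowenEntropyAt f E ε) ε hε)
  refine le_iInf₂ fun s hs => ?_
  by_contra! hcon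
  have hsσ : (s : ℝ) < σ := by
    rw [← ENNReal.ofReal_coe_nnreal] at hcon
    exact (ENNReal.ofReal_lt_ofReal_iff_of_nonneg s.2).1 hcon
  have h0 : bowenPremeasure f E s 0 ε < (ENNReal.ofReal C)⁻¹ := by
    have h1 : bowenPremeasure f E s 0 ε ≤ 0 := by
      rw [← hs]
      exact le_iSup (fun N => bowenPremeasure f E s N ε) 0
    exact h1.trans_lt (by simp)
  simp only [bowenPremeasure, iInf_lt_iff] at h0
  obtain ⟨D, hD, _, hcov, hsum⟩ := h0
  have h2 : (1 : ℝ≥0∞) ≤ ENNReal.ofReal C *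
      ∑' c : D, ENNReal.ofReal (Real.exp (-(s : ℝ) * (c.1.2 : ℝ))) := by
    rw [← hν, ← ENNReal.tsum_mul_left]
    refine (measure_mono hcov).trans ((measure_biUnion_le ν hD _).trans ?_)
    refine ENNReal.tsum_le_tsum fun c => (h _ _).trans ?_
    rw [← ENNReal.ofReal_mul hC.le]
    refine ENNReal.ofReal_le_ofReal (mul_le_mul_of_nonneg_left (Real.exp_le_exp.2 ?_) hC.le)
    have : (0 : ℝ) ≤ (c : X × ℕ).2 := Nat.cast_nonneg _
    nlinarith
  have hC0 : ENNReal.ofReal C ≠ 0 := by simpa using hC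
  have h3 := ENNReal.mul_lt_mul_right hC0 ENNReal.ofReal_ne_top hsum
  rw [ENNReal.mul_inv_cancel hC0 ENNReal.ofReal_ne_top] at h3
  exact absurd h2 (not_le.2 h3)

/-- Mass distribution principle for the Hausdorff dimension. -/
theorem le_dimH_of_outerMeasure {E : Set X} {ν : OuterMeasure X} (hν : ν E ≠ 0)
    {C σ δ : ℝ} (hδ : 0 < δ)
    (h : ∀ d, 0 < d → d ≤ δ → ∀ U : Set X, (∀ x ∈ U, ∀ x' ∈ U, dist x x' ≤ d) →
      ν U ≤ ENNReal.ofReal (C * d ^ σ)) :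
    ENNReal.ofReal σ ≤ dimH E := by
  borelize X
  refine ENNReal.le_of_forall_nnreal_lt fun s hs => ?_
  have hsσ : (s : ℝ) < σ := by
    rw [← ENNReal.ofReal_coe_nnreal] at hs
    exact (ENNReal.ofReal_lt_ofReal_iff_of_nonneg s.2).1 hs
  rcases eq_or_ne s 0 with rfl | hs0
  · simp
  have hspos : (0 : ℝ) < s := by
    rw [NNReal.coe_pos]
    exact pos_iff_ne_zero.2 hs0
  obtain ⟨d₀, hd₀, hd₀δ, hd₀C⟩ : ∃ d₀ > 0, d₀ ≤ δ ∧ ∀ d, 0 < d → d < d₀ → C * d ^ (σ - s) ≤ 1 := by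
    have h1 : ContinuousAt (fun d : ℝ => C * d ^ (σ - s)) 0 :=
      continuousAt_const.mul (Real.continuousAt_rpow_const _ _ (Or.inr (by linarith)))
    have h2 : ∀ᶠ d in 𝓝 (0 : ℝ), C * d ^ (σ - s) < 1 := by
      refine h1.eventually (gt_mem_nhds ?_)
      dsimp only
      rw [Real.zero_rpow (by linarith), mul_zero]
      exact one_pos
    obtain ⟨r, hr, hr'⟩ := Metric.eventually_nhds_iff.1 h2
    refine ⟨min r δ, lt_min hr hδ, min_le_right _ _, fun d hd hd' => (hr' ?_).le⟩
    rw [Real.dist_eq, sub_zero, abs_of_pos hd]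
    exact hd'.trans_le (min_le_left _ _)
  refine le_dimH_of_hausdorffMeasure_ne_zero fun hzero => hν ?_
  have hle : ν ≤ OuterMeasure.mkMetric fun r => r ^ (s : ℝ) := by
    refine OuterMeasure.le_mkMetric _ ν (ENNReal.ofReal (d₀ / 2)) (by simpa using hd₀) ?_
    intro U hU
    have htop : Metric.ediam U ≠ ∞ := ne_top_of_le_ne_top ENNReal.ofReal_ne_top hU
    set D := (Metric.ediam U).toReal with hD
    have hD0 : 0 ≤ D := ENNReal.toReal_nonneg
    have hDle : D ≤ d₀ / 2 := ENNReal.toReal_le_of_le_ofReal (by positivity) hU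
    have hUD : ∀ x ∈ U, ∀ x' ∈ U, dist x x' ≤ D := fun x hx x' hx' => by
      rw [dist_edist]
      exact ENNReal.toReal_mono htop (Metric.edist_le_ediam_of_mem hx hx')
    -- The diameter `D` may be `0`, where the hypothesis says nothing; it is approached from above.
    have hev : ∀ᶠ d in 𝓝[>] D, ν U ≤ ENNReal.ofReal (d ^ (s : ℝ)) := by
      have hlt : D < d₀ := by linarith
      filter_upwards [Ioo_mem_nhdsGT hlt] with d hd
      have hdpos : 0 < d := hD0.trans_lt hd.1
      refine (h d hdpos (hd.2.le.trans hd₀δ) U fun x hx x' hx' =>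
        (hUD x hx x' hx').trans hd.1.le).trans (ENNReal.ofReal_le_ofReal ?_)
      have h3 : d ^ σ = d ^ (σ - s) * d ^ (s : ℝ) := by
        rw [← Real.rpow_add hdpos, sub_add_cancel]
      rw [h3, ← mul_assoc]
      have h4 : 0 ≤ d ^ (s : ℝ) := by positivity
      nlinarith [hd₀C d hdpos hd.2]
    have hcont : Tendsto (fun d : ℝ => ENNReal.ofReal (d ^ (s : ℝ))) (𝓝[>] D)
        (𝓝 (ENNReal.ofReal (D ^ (s : ℝ)))) :=
      (ENNReal.continuous_ofReal.continuousAt.comp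
        (Real.continuousAt_rpow_const D s (Or.inr hspos.le))).tendsto.mono_left nhdsWithin_le_nhds
    have hfin := ge_of_tendsto hcont hev
    rwa [← ENNReal.ofReal_rpow_of_nonneg hD0 hspos.le, hD, ENNReal.ofReal_toReal htop] at hfin
  have h5 := hle E
  rw [OuterMeasure.coe_mkMetric] at h5
  exact le_antisymm (h5.trans hzero.le) bot_le

/-- If the mass of a set of diameter at most `d` decays along `⌊κ log (δ / d)⌋` steps, then the
dimension is bounded below by the corresponding rate. -/
theorem le_dimH_of_floor_decay {E : Set X} {ν : OuterMeasure X} (hν : ν E ≠ 0)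
    {C y ρ κ₁ κ₂ δ : ℝ} (hC : 0 ≤ C) (hy : 0 ≤ y) (hρ : 0 ≤ ρ) (hδ : 0 < δ)
    (h : ∀ d, 0 < d → d ≤ δ → ∀ U : Set X, (∀ x ∈ U, ∀ x' ∈ U, dist x x' ≤ d) →
      ν U ≤ ENNReal.ofReal (C * Real.exp (-(y *
        (ρ * ⌊κ₂ * Real.log (δ / d)⌋₊ + ⌊κ₁ * Real.log (δ / d)⌋₊))))) :
    ENNReal.ofReal (y * (κ₁ + κ₂ * ρ)) ≤ dimH E := by
  set σ := y * (κ₁ + κ₂ * ρ) with hσ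
  -- Each floor loses at most one step, whence the factor `exp (y * (ρ + 1))`.
  refine le_dimH_of_outerMeasure hν (C := C * Real.exp (y * (ρ + 1)) * δ ^ (-σ)) (σ := σ) hδ
    fun d hd hdδ U hU => (h d hd hdδ U hU).trans (ENNReal.ofReal_le_ofReal ?_)
  have hpow : δ ^ (-σ) * d ^ σ = Real.exp (-(σ * Real.log (δ / d))) := by
    rw [Real.rpow_def_of_pos hδ, Real.rpow_def_of_pos hd, ← Real.exp_add,
      Real.log_div hδ.ne' hd.ne']
    congr 1
    ring
  rw [mul_assoc, hpow, mul_assoc, ← Real.exp_add]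
  refine mul_le_mul_of_nonneg_left (Real.exp_le_exp.2 ?_) hC
  have h1 := (Nat.lt_floor_add_one (κ₁ * Real.log (δ / d))).le
  have h2 := mul_le_mul_of_nonneg_left (Nat.lt_floor_add_one (κ₂ * Real.log (δ / d))).le hρ
  have h3 := mul_le_mul_of_nonneg_left (add_le_add h1 h2) hy
  rw [hσ]
  linarith

end ShrinkingTarget

/-! ### Entropy and dimension bounds, and passage to the limit -/

namespace ShrinkingTarget

variable {X : Type*} [MetricSpace X]

theorem IsCoding.le_bowenEntropy {f : X → X} {W : Set ℤ} {orb : ℤ → X → X}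
    (ho : OrbitWindow f W orb) (hW : Set.Ici 0 ⊆ W) {E : Set X} {y ρ : ℝ} (hy : 0 ≤ y)
    {A : Finset X} {P : ℕ} {δ : ℝ}
    {Fr : Set ℤ} {code : (ℤ → A) → X} (hc : IsCoding f W orb E y ρ A P δ Fr code) :
    ENNReal.ofReal (y * ρ) ≤ bowenEntropy f E := by
  obtain ⟨ν, C, hC, hν, hbound⟩ := hc.exists_outerMeasure ho hy
  refine le_bowenEntropy_of_outerMeasure hν hC (half_pos hc.scale_pos) fun n x => ?_
  have := hbound 0 n (bowenBall f n x (δ / 2)) (fun a ha => hW (by simpa using ha)) (by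
    intro x₁ h₁ x₂ h₂ a ha han
    lift a to ℕ using by simpa using ha
    rw [ho.orb_natCast, ho.orb_natCast]
    have h3 := h₁ a (by exact_mod_cast han)
    have h4 := h₂ a (by exact_mod_cast han)
    have h5 := dist_triangle_left (f^[a] x₁) (f^[a] x₂) (f^[a] x)
    linarith)
  simpa [mul_assoc] using this

theorem pow_floor_mul_le {L d δ : ℝ} (hL : 1 < L) (hd : 0 < d) (hdδ : d ≤ δ) {n : ℕ}
    (hn : n ≤ ⌊1 / Real.log L * Real.log (δ / d)⌋₊) : L ^ n * d ≤ δ := by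
  have hlog : 0 < Real.log L := Real.log_pos hL
  have hδ : 0 < δ := hd.trans_le hdδ
  have h1 : 0 ≤ Real.log (δ / d) := Real.log_nonneg ((one_le_div hd).2 hdδ)
  have h2 : (n : ℝ) ≤ 1 / Real.log L * Real.log (δ / d) :=
    le_trans (by exact_mod_cast hn) (Nat.floor_le (by positivity))
  rw [one_div, inv_mul_eq_div, le_div_iff₀ hlog, ← Real.log_pow,
    Real.log_le_log_iff (by positivity) (by positivity), le_div_iff₀ hd] at h2
  exact h2

theorem dist_iterate_le {f : X → X} {L : ℝ≥0} (hf : LipschitzWith L f) (n : ℕ) {x x' : X} {d : ℝ}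
    (h : dist x x' ≤ d) : dist (f^[n] x) (f^[n] x') ≤ (L : ℝ) ^ n * d := by
  have h1 := (hf.iterate n).dist_le_mul x x'
  push_cast at h1
  exact h1.trans (mul_le_mul_of_nonneg_left h (by positivity))

theorem IsCoding.le_dimH_of_lipschitz {f : X → X} {W : Set ℤ} {orb : ℤ → X → X}
    (ho : OrbitWindow f W orb) (hW : Set.Ici 0 ⊆ W) {E : Set X} {y ρ : ℝ} (hy : 0 ≤ y)
    (hρ : 0 ≤ ρ) {A : Finset X} {P : ℕ} {δ : ℝ}
    {Fr : Set ℤ} {code : (ℤ → A) → X} (hc : IsCoding f W orb E y ρ A P δ Fr code)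
    {L : ℝ≥0} (hL : 1 < L) (hf : LipschitzWith L f) :
    ENNReal.ofReal (y * (0 + 1 / Real.log L * ρ)) ≤ dimH E := by
  obtain ⟨ν, C, hC, hν, hbound⟩ := hc.exists_outerMeasure ho hy
  have hL' : (1 : ℝ) < L := by exact_mod_cast hL
  have hδ := hc.scale_pos
  refine le_dimH_of_floor_decay (by rw [hν]; exact one_ne_zero) hC.le hy hρ (half_pos hδ)
    fun d hd hdδ U hU => ?_
  rw [zero_mul, Nat.floor_zero]
  refine hbound 0 _ U (fun a ha => hW (by simpa using ha)) ?_
  intro x hx x' hx' a ha han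
  lift a to ℕ using by simpa using ha
  rw [ho.orb_natCast, ho.orb_natCast]
  have h1 := dist_iterate_le hf a (hU x hx x' hx')
  have h2 := pow_floor_mul_le hL' hd hdδ (n := a) (by omega)
  linarith

/-- Nearby points stay close both forward, through `L₂`, and backward, through `L₁`. The backward
steps carry no factor `ρ` because all negative cells are free. -/
theorem IsCoding.le_dimH_of_biLipschitz {e : X ≃ₜ X} {E : Set X} {y ρ : ℝ} (hy : 0 ≤ y)
    (hρ : 0 ≤ ρ) {A : Finset X} {P : ℕ} {δ : ℝ} {Fr : Set ℤ} {code : (ℤ → A) → X}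
    (hc : IsCoding e Set.univ (fun a => ⇑(e ^ a)) E y ρ A P δ Fr code)
    {L₁ L₂ : ℝ≥0} (hL₁ : 1 < L₁) (hL₂ : 1 < L₂)
    (he₁ : LipschitzWith L₁ e.symm) (he₂ : LipschitzWith L₂ e) :
    ENNReal.ofReal (y * (1 / Real.log L₁ + 1 / Real.log L₂ * ρ)) ≤ dimH E := by
  obtain ⟨ν, C, hC, hν, hbound⟩ := hc.exists_outerMeasure (OrbitWindow.twoSided e) hy
  have hL₁' : (1 : ℝ) < L₁ := by exact_mod_cast hL₁
  have hL₂' : (1 : ℝ) < L₂ := by exact_mod_cast hL₂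
  have hδ := hc.scale_pos
  refine le_dimH_of_floor_decay (by rw [hν]; exact one_ne_zero) hC.le hy hρ (half_pos hδ)
    fun d hd hdδ U hU => hbound _ _ U (fun _ _ => trivial) ?_
  intro x hx x' hx' a ha han
  rcases le_total 0 a with h0 | h0
  · lift a to ℕ using h0
    rw [zpow_natCast, coe_homeomorph_pow, coe_homeomorph_pow]
    have h1 := dist_iterate_le he₂ a (hU x hx x' hx')
    have h2 := pow_floor_mul_le hL₂' hd hdδ (n := a) (by omega)
    linarith
  · obtain ⟨n, rfl⟩ : ∃ n : ℕ, a = -n := ⟨a.natAbs, by omega⟩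
    have h3 : e ^ (-(n : ℤ)) = e.symm ^ n := by
      rw [zpow_neg, zpow_natCast, ← inv_pow]
      rfl
    rw [h3, coe_homeomorph_pow, coe_homeomorph_pow]
    have h1 := dist_iterate_le he₁ n (hU x hx x' hx')
    have h2 := pow_floor_mul_le hL₁' hd hdδ (n := n) (by omega)
    linarith

/-- Continuity in `ρ` gives the bound at `R`; dividing by the positive coefficient then lets `y`
increase to `h`, which may be infinite. -/
theorem coe_mul_le_of_forall_lt {κ₁ κ₂ R : ℝ} (hR : 0 < R) (hκ : 0 < κ₁ + κ₂ * R) {h : EReal}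
    {b : ℝ≥0∞}
    (H : ∀ y ρ : ℝ, 0 ≤ y → (y : EReal) < h → 0 ≤ ρ → ρ < R →
      ENNReal.ofReal (y * (κ₁ + κ₂ * ρ)) ≤ b) :
    ((κ₁ + κ₂ * R : ℝ) : EReal) * h ≤ (b : EReal) := by
  have key : ∀ y : ℝ, 0 ≤ y → (y : EReal) < h → ((y * (κ₁ + κ₂ * R) : ℝ) : EReal) ≤ b := by
    intro y hy hyh
    have hcont : Tendsto (fun ρ : ℝ => ENNReal.ofReal (y * (κ₁ + κ₂ * ρ))) (𝓝[<] R)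
        (𝓝 (ENNReal.ofReal (y * (κ₁ + κ₂ * R)))) := by
      refine Tendsto.mono_left (Continuous.tendsto ?_ R) nhdsWithin_le_nhds
      exact ENNReal.continuous_ofReal.comp (by fun_prop)
    have hle : ENNReal.ofReal (y * (κ₁ + κ₂ * R)) ≤ b := by
      refine le_of_tendsto hcont ?_
      filter_upwards [Ioo_mem_nhdsLT hR] with ρ hρ
      exact H y ρ hy hyh hρ.1.le hρ.2
    have h1 := EReal.coe_ennreal_le_coe_ennreal_iff.2 hle
    rw [EReal.coe_ennreal_ofReal] at h1
    exact le_trans (by exact_mod_cast le_max_left _ _) h1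
  have hcoef : (0 : EReal) < ((κ₁ + κ₂ * R : ℝ) : EReal) := by exact_mod_cast hκ
  rw [mul_comm, ← EReal.le_div_iff_mul_le hcoef (EReal.coe_ne_top _)]
  refine EReal.ge_of_forall_gt_iff_ge.1 fun y hy => ?_
  rcases le_total 0 y with h0 | h0
  · rw [EReal.le_div_iff_mul_le hcoef (EReal.coe_ne_top _)]
    exact_mod_cast key y h0 hy
  · exact le_trans (by exact_mod_cast h0) (EReal.div_nonneg (EReal.coe_ennreal_nonneg b) hcoef.le)

/-- A Lipschitz constant may be replaced by one larger than `1` without decreasing the inverse of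
its logarithm. -/
theorem exists_one_lt_inv_log_le (L : ℝ≥0) :
    ∃ L' : ℝ≥0, L ≤ L' ∧ 1 < L' ∧ 1 / Real.log L ≤ 1 / Real.log L' := by
  rcases lt_or_ge 1 L with h | h
  · exact ⟨L, le_rfl, h, le_rfl⟩
  · refine ⟨2, h.trans one_le_two, one_lt_two, ?_⟩
    have h1 : Real.log L ≤ 0 := Real.log_nonpos L.2 (by exact_mod_cast h)
    have h2 : 0 < Real.log ((2 : ℝ≥0) : ℝ) := Real.log_pos (by norm_num)
    exact (div_nonpos_of_nonneg_of_nonpos zero_le_one h1).trans (by positivity)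

theorem ratio_pos {l₁ l₂ τ : ℝ} (hl₁ : 0 < l₁) (hl₂ : 0 < l₂) (h0 : 0 ≤ τ) (h : τ < l₁) :
    0 < ratio l₁ l₂ τ := by
  refine div_pos ?_ (by positivity)
  nlinarith

end ShrinkingTarget

open ShrinkingTarget in
theorem theorem1p1 {X : Type*} [MetricSpace X] [CompactSpace X] [Nontrivial X]
    (f : X → X) (hf : Continuous f) (hsurj : Function.Surjective f)
    (l₁ l₂ ε₀ : ℝ) (hl₁ : 0 < l₁) (hl₂ : 0 < l₂) (hε₀ : 0 < ε₀)
    (hspec : ShrinkingTarget.ExpNonuniformSpecification f l₁ l₂ ε₀)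
    (φ : ℕ → ℕ → ℝ) (hφ : ∀ j n, 0 < φ j n ∧ φ j n ≤ 1)
    (z : ℕ → ℕ → X)
    (s : ℕ → ℕ → ℕ) (hs : ∀ j, Tendsto (s j) atTop atTop)
    (τ : EReal) (hτ : τ = ⨆ j, ShrinkingTarget.shrinkingRate (φ j)) (hτl : τ < (l₁ : EReal))
    (E : Set X)
    (hE : E = ⋂ j, ShrinkingTarget.targetSet f (φ j) (z j) (Set.range (s j))) :
    E.Nonempty ∧
    (ShrinkingTarget.ratio l₁ l₂ τ.toReal : EReal) * Dynamics.coverEntropy f Set.univ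
      ≤ (ShrinkingTarget.bowenEntropy f E : EReal) ∧
    (∀ L : ℝ≥0, LipschitzWith L f →
      ((1 / Real.log L * ShrinkingTarget.ratio l₁ l₂ τ.toReal : ℝ) : EReal)
          * Dynamics.coverEntropy f Set.univ
        ≤ (dimH E : EReal)) ∧
    (∀ (L₁ L₂ : ℝ≥0) (e : X ≃ₜ X), ⇑e = f → LipschitzWith L₁ e.symm → LipschitzWith L₂ e →
      ((1 / Real.log L₁ + 1 / Real.log L₂ * ShrinkingTarget.ratio l₁ l₂ τ.toReal : ℝ) : EReal)
          * Dynamics.coverEntropy f Set.univ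
        ≤ (dimH E : EReal)) := by
  have hτ0 : 0 ≤ τ := by
    rw [hτ]
    exact (shrinkingRate_nonneg (hφ 0)).trans (le_iSup (fun j => shrinkingRate (φ j)) 0)
  have hτcoe : (τ.toReal : EReal) = τ :=
    EReal.coe_toReal (ne_top_of_lt hτl) (ne_bot_of_le_ne_bot (by simp) hτ0)
  have hR : 0 < ratio l₁ l₂ τ.toReal :=
    ratio_pos hl₁ hl₂ (EReal.toReal_nonneg hτ0) (by
      rw [← hτcoe] at hτl
      exact_mod_cast hτl)
  have hh : 0 ≤ Dynamics.coverEntropy f Set.univ :=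
    Dynamics.coverEntropy_nonneg f Set.univ_nonempty
  have ho := OrbitWindow.forward hf hsurj
  have hcoding : ∀ {W orb}, OrbitWindow f W orb → ∀ {y ρ : ℝ},
      (y : EReal) < Dynamics.coverEntropy f Set.univ → 0 ≤ ρ → ρ < ratio l₁ l₂ τ.toReal →
      ∃ A P δ Fr code, IsCoding f W orb E y ρ A P δ Fr code := by
    intro W orb hW y ρ hy hρ hρτ
    rw [hE]
    exact hW.exists_isCoding hf hsurj hl₁ hl₂ hε₀ hspec hφ z hs hτ hτl hρ hρτ hy
  refine ⟨?_, ?_, ?_, ?_⟩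
  -- A negative `y` is strictly below the entropy even when the latter is `0`.
  · obtain ⟨A, P, δ, Fr, code, hc⟩ := hcoding ho (y := -1) (ρ := 0)
      (lt_of_lt_of_le (by exact_mod_cast neg_one_lt_zero) hh) le_rfl hR
    obtain ⟨a, ha⟩ := hc.nonempty
    exact ⟨_, hc.mem fun _ => ⟨a, ha⟩⟩
  · have h1 := coe_mul_le_of_forall_lt (κ₁ := 0) (κ₂ := 1) (b := bowenEntropy f E) hR
      (by simpa using hR) (h := Dynamics.coverEntropy f Set.univ) (by
        intro y ρ hy hyh hρ hρR
        obtain ⟨A, P, δ, Fr, code, hc⟩ := hcoding ho hyh hρ hρR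
        rw [zero_add, one_mul]
        exact hc.le_bowenEntropy ho subset_rfl hy)
    rwa [zero_add, one_mul] at h1
  · intro L hL
    obtain ⟨L', hLL', hL', hlog⟩ := exists_one_lt_inv_log_le L
    have hlog' : 0 < 1 / Real.log L' := one_div_pos.2 (Real.log_pos (by exact_mod_cast hL'))
    have h1 := coe_mul_le_of_forall_lt (κ₁ := 0) (κ₂ := 1 / Real.log L') (b := dimH E) hR
      (by rw [zero_add]; positivity) (h := Dynamics.coverEntropy f Set.univ) (by
        intro y ρ hy hyh hρ hρR
        obtain ⟨A, P, δ, Fr, code, hc⟩ := hcoding ho hyh hρ hρR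
        exact hc.le_dimH_of_lipschitz ho subset_rfl hy hρ hL' (hL.weaken hLL'))
    refine le_trans (mul_le_mul_of_nonneg_right (EReal.coe_le_coe_iff.2 ?_) hh) h1
    rw [zero_add]
    exact mul_le_mul_of_nonneg_right hlog hR.le
  · rintro L₁ L₂ e rfl hL₁ hL₂
    obtain ⟨L₁', hLL₁', hL₁', hlog₁⟩ := exists_one_lt_inv_log_le L₁
    obtain ⟨L₂', hLL₂', hL₂', hlog₂⟩ := exists_one_lt_inv_log_le L₂
    have hlog₁' : 0 < 1 / Real.log L₁' := one_div_pos.2 (Real.log_pos (by exact_mod_cast hL₁'))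
    have hlog₂' : 0 < 1 / Real.log L₂' := one_div_pos.2 (Real.log_pos (by exact_mod_cast hL₂'))
    have h1 := coe_mul_le_of_forall_lt (κ₁ := 1 / Real.log L₁') (κ₂ := 1 / Real.log L₂')
      (b := dimH E) hR (by positivity) (h := Dynamics.coverEntropy e Set.univ) (by
        intro y ρ hy hyh hρ hρR
        obtain ⟨A, P, δ, Fr, code, hc⟩ := hcoding (OrbitWindow.twoSided e) hyh hρ hρR
        exact hc.le_dimH_of_biLipschitz hy hρ hL₁' hL₂' (hL₁.weaken hLL₁') (hL₂.weaken hLL₂'))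
    refine le_trans (mul_le_mul_of_nonneg_right (EReal.coe_le_coe_iff.2 ?_) hh) h1
    exact add_le_add hlog₁ (mul_le_mul_of_nonneg_right hlog₂ hR.le)
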